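/- Let $G$ be a finite simple connected graph of diameter at least $4$, and let $\lambda\neq 0$ be a real number that is an eigenvalue of the adjacency matrix $A(G)$. Then $$m_\lambda(G)\le \beta'(G)+c(G)-1 .$$ Here $m_\lambda(G)$ is the multiplicity of $\lambda$ as an eigenvalue of $A(G)$; $\beta'(G)$ is the induced matching number of $G$, i.e. the maximum number of edges in a matching $M$ of $G$ such that no edge of $G$ connects endpoints of two distinct edges of $M$; and $c(G)=|E(G)|-|V(G)|+\omega(G)$ is the cyclomatic number of $G$, where $\omega(G)$ is the number of connected components of $G$. -/

import Mathlib

namespace GraphMultiplicity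

/-- The multiplicity of the real number `μ` as an eigenvalue of the adjacency matrix of `G`, that is
the dimension of the eigenspace `{x | A x = μ x}`. It is the algebraic multiplicity too, as the
matrix is real symmetric. -/
noncomputable def eigenMult {V : Type*} [Fintype V] [DecidableEq V] (G : SimpleGraph V)
    [DecidableRel G.Adj] (μ : ℝ) : ℕ :=
  Module.finrank ℝ (Module.End.eigenspace (Matrix.toLin' (G.adjMatrix ℝ)) μ)

/-- A matching `M` of `G` (given as the subgraph formed by its edges and their endpoints) is an
induced matching if no edge of `G` connects endpoints of distinct edges of `M`, that is, if the
only edges of `G` between vertices of `M` are the edges of `M`. -/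
def IsInducedMatching {V : Type*} {G : SimpleGraph V} (M : G.Subgraph) : Prop :=
  M.IsMatching ∧ M.IsInduced

/-- The induced matching number: the largest number of edges of an induced matching
(for a finite graph the supremum is over a non-empty bounded set). -/
noncomputable def inducedMatchingNumber {V : Type*} (G : SimpleGraph V) : ℕ :=
  sSup {k : ℕ | ∃ M : G.Subgraph, IsInducedMatching M ∧ M.edgeSet.ncard = k}

/-- The cyclomatic number `|E(G)| - |V(G)| + ω(G)`, with `ω(G)` the number of connected
components, as an integer. -/
noncomputable def cyclomaticNumber {V : Type*} (G : SimpleGraph V) : ℤ :=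
  (G.edgeSet.ncard : ℤ) - (Nat.card V : ℤ) + (Nat.card G.ConnectedComponent : ℤ)

end GraphMultiplicity

/-!
Write `β'` for the induced matching number, `c` for the cyclomatic number and `m` for the
multiplicity of `μ ≠ 0`. All graphs live on the same vertex set: "deleting" a vertex means deleting
its incident edges, which is harmless because isolated vertices change none of `β'`, `c`, `m`
(for `m` this uses `μ ≠ 0`).

The bound `m ≤ β' + c` holds for every graph (`multiplicity_le`). Deleting a vertex on a cycle
lowers `c` and lowers `m` by at most one. In an acyclic graph with an edge there is a vertex `v`
having a pendant neighbour, all of whose neighbours except one vertex `u` are pendant. An eigenvector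
vanishing at `v` vanishes at its pendant neighbours, hence at `u`, so deleting `v` and `u` lowers `m`
by at most one, and it lowers `β'` because the pendant edge at `v` can be added to any induced
matching of the rest.

Call a graph tight if it attains this bound. Equality then holds in each deletion step, so the
smaller graph is tight too and every eigenvector of the smaller graph is an eigenvector of the
larger one. Together with the fact that each non-isolated vertex of a tight graph supports some
eigenvector (`IsTight.exists_ne_zero`), this restricts how the pieces are attached: a component of
the smaller graph joined by a single edge to a deleted vertex (`v` in the cyclic case, `u` in the
acyclic case) is a single vertex.

Consequently the components of a tight graph have diameter at most three
(`IsTight.exists_walk_length_le_three`), by induction on the number of edges. Suppose that `p` and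
`q` are connected. If they stay connected after the deletion, induction applies. If they are
disconnected by the deletion of a cycle vertex `x`, then one of them is `x` or is pendant at `x`;
each of `p` and `q` is so related to at most one cycle vertex, whereas a cycle has at least three
vertices. In the acyclic case, if they are disconnected, then both lie within distance one of the
edge `uv`. A connected graph of diameter at least four is therefore not tight.
-/

open SimpleGraph

namespace GraphMultiplicity

variable {V : Type*}

/-! ### Reachability after deleting a vertex -/

/-- `v` lies on a cycle of `H`, phrased without walks: two distinct neighbours of `v` are
connected to each other in `H - v`. -/
def OnCycle (H : SimpleGraph V) (v : V) : Prop :=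
  ∃ a b, a ≠ b ∧ H.Adj v a ∧ H.Adj v b ∧ (H.deleteIncidenceSet v).Reachable a b

/-- `l` is a pendant vertex of `H` whose only neighbour is `v`. -/
def IsPendant (H : SimpleGraph V) (v l : V) : Prop :=
  H.Adj v l ∧ ∀ w, H.Adj l w → w = v

lemma deleteIncidenceSet_mono {K H : SimpleGraph V} (h : K ≤ H) (v : V) :
    K.deleteIncidenceSet v ≤ H.deleteIncidenceSet v := by
  intro a b hab
  rw [deleteIncidenceSet_adj] at hab ⊢
  exact ⟨h hab.1, hab.2⟩

lemma OnCycle.mono {K H : SimpleGraph V} (h : K ≤ H) {v : V} (hv : OnCycle K v) :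
    OnCycle H v := by
  obtain ⟨a, b, hne, ha, hb, hr⟩ := hv
  exact ⟨a, b, hne, h ha, h hb, hr.mono (deleteIncidenceSet_mono h v)⟩

lemma eq_of_reachable_of_isolated {K : SimpleGraph V} {v a : V} (hv : ∀ w, ¬ K.Adj v w)
    (h : K.Reachable v a) : a = v := by
  obtain ⟨p⟩ := h
  cases p with
  | nil => rfl
  | cons h _ => exact absurd h (hv _)

lemma eq_of_reachable_deleteIncidenceSet {H : SimpleGraph V} {v a : V}
    (h : (H.deleteIncidenceSet v).Reachable v a) : a = v :=
  eq_of_reachable_of_isolated (fun _ hw => (deleteIncidenceSet_adj.1 hw).2.1 rfl) h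

/-- A walk either survives the deletion of `v` or leads from its start to `v`. -/
lemma reachable_deleteIncidenceSet_or {H : SimpleGraph V} (v : V) {a b : V}
    (h : H.Reachable a b) :
    (H.deleteIncidenceSet v).Reachable a b ∨ a = v ∨
      ∃ n, H.Adj v n ∧ (H.deleteIncidenceSet v).Reachable a n := by
  obtain ⟨p⟩ := h
  induction p with
  | nil => exact Or.inl (Reachable.refl _)
  | @cons a a' b hadj p ih =>
    by_cases ha : a = v
    · exact Or.inr (Or.inl ha)
    by_cases ha' : a' = v
    · subst ha'
      exact Or.inr (Or.inr ⟨a, hadj.symm, Reachable.refl _⟩)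
    have hr : (H.deleteIncidenceSet v).Reachable a a' :=
      (deleteIncidenceSet_adj.2 ⟨hadj, ha, ha'⟩ : (H.deleteIncidenceSet v).Adj a a').reachable
    rcases ih with h | h | ⟨n, hn, h⟩
    · exact Or.inl (hr.trans h)
    · exact absurd h ha'
    · exact Or.inr (Or.inr ⟨n, hn, hr.trans h⟩)

/-- A neighbour of `v` through which a cycle at `v` passes is itself on a cycle. -/
lemma onCycle_of_adj {H : SimpleGraph V} {v a b : V} (hab : a ≠ b) (ha : H.Adj v a)
    (hb : H.Adj v b) (hr : (H.deleteIncidenceSet v).Reachable a b) : OnCycle H a := by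
  rcases reachable_deleteIncidenceSet_or a hr.symm with h | h | ⟨n, hn, h⟩
  · exact absurd (eq_of_reachable_deleteIncidenceSet h.symm).symm hab
  · exact absurd h.symm hab
  · rw [deleteIncidenceSet_adj] at hn
    refine ⟨v, n, hn.2.2.symm, ha.symm, hn.1, ?_⟩
    have hvb : (H.deleteIncidenceSet a).Adj v b :=
      deleteIncidenceSet_adj.2 ⟨hb, ha.ne, hab.symm⟩
    exact hvb.reachable.trans
      (h.mono (deleteIncidenceSet_mono (H.deleteIncidenceSet_le v) a))

lemma IsPendant.not_onCycle {H : SimpleGraph V} {v l : V} (h : IsPendant H v l) :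
    ¬ OnCycle H l := by
  rintro ⟨a, b, hne, ha, hb, -⟩
  exact hne ((h.2 a ha).trans (h.2 b hb).symm)

lemma edgeSet_ncard_deleteIncidenceSet [Finite V] (H : SimpleGraph V) (v : V) :
    (H.deleteIncidenceSet v).edgeSet.ncard + (H.neighborSet v).ncard = H.edgeSet.ncard := by
  classical
  have := Fintype.ofFinite V
  have h1 := H.card_edgeFinset_deleteIncidenceSet v
  have h2 := H.degree_le_card_edgeFinset v
  rw [← coe_edgeFinset, ← coe_edgeFinset, Set.ncard_coe_finset, Set.ncard_coe_finset,
    ← coe_neighborFinset, Set.ncard_coe_finset, card_neighborFinset_eq_degree]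
  omega

lemma edgeSet_ncard_deleteIncidenceSet_lt [Finite V] {H : SimpleGraph V} {v w : V}
    (h : H.Adj v w) : (H.deleteIncidenceSet v).edgeSet.ncard < H.edgeSet.ncard := by
  have h1 := edgeSet_ncard_deleteIncidenceSet H v
  have h2 : 0 < (H.neighborSet v).ncard := (Set.ncard_pos (Set.toFinite _)).2 ⟨w, h⟩
  omega

lemma edgeSet_ncard_mono [Finite V] {K H : SimpleGraph V} (h : K ≤ H) :
    K.edgeSet.ncard ≤ H.edgeSet.ncard :=
  Set.ncard_le_ncard (edgeSet_mono h) (Set.toFinite _)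

/-! ### The cyclomatic number after deleting a vertex -/

/-- The components of `H - v` that meet `D` are counted by `D`; any other is `{v}` or already a
component of `H`. -/
lemma card_connectedComponent_deleteIncidenceSet_le [Finite V] (H : SimpleGraph V) (v : V)
    (D : Set V)
    (hD : ∀ n, H.Adj v n → ∃ d ∈ D, (H.deleteIncidenceSet v).Reachable n d) :
    Nat.card (H.deleteIncidenceSet v).ConnectedComponent ≤
      Nat.card H.ConnectedComponent + D.ncard := by
  classical
  set K := H.deleteIncidenceSet v with hK
  let f : K.ConnectedComponent → H.ConnectedComponent ⊕ D := fun C =>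
    if h : ∃ d ∈ D, K.connectedComponentMk d = C then Sum.inr ⟨h.choose, h.choose_spec.1⟩
    else Sum.inl (C.map (Hom.ofLE (H.deleteIncidenceSet_le v)))
  have hf : Function.Injective f := by
    intro C C' hCC
    by_cases h : ∃ d ∈ D, K.connectedComponentMk d = C <;>
      by_cases h' : ∃ d ∈ D, K.connectedComponentMk d = C'
    · simp only [f, dif_pos h, dif_pos h', Sum.inr.injEq, Subtype.mk.injEq] at hCC
      rw [← h.choose_spec.2, ← h'.choose_spec.2, hCC]
    · simp only [f, dif_pos h, dif_neg h', reduceCtorEq] at hCC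
    · simp only [f, dif_neg h, dif_pos h', reduceCtorEq] at hCC
    · simp only [f, dif_neg h, dif_neg h', Sum.inl.injEq] at hCC
      induction C using ConnectedComponent.ind with | _ a
      induction C' using ConnectedComponent.ind with | _ b
      have hab : H.Reachable a b := ConnectedComponent.exact hCC
      have key : ∀ {x y : V}, (¬ ∃ d ∈ D, K.connectedComponentMk d = K.connectedComponentMk x) →
          H.Reachable x y → K.Reachable x y ∨ x = v := by
        intro x y hx hxy
        rcases reachable_deleteIncidenceSet_or v hxy with h1 | h1 | ⟨n, hn, h1⟩
        · exact Or.inl h1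
        · exact Or.inr h1
        · obtain ⟨d, hd, hnd⟩ := hD n hn
          exact absurd ⟨d, hd, ConnectedComponent.sound (h1.trans hnd).symm⟩ hx
      apply ConnectedComponent.sound
      rcases key h hab with h1 | h1
      · exact h1
      rcases key h' hab.symm with h2 | h2
      · exact h2.symm
      · rw [h1, h2]
  have := Nat.card_le_card_of_injective f hf
  rwa [Nat.card_sum] at this

lemma cyclomaticNumber_deleteIncidenceSet_le [Finite V] (H : SimpleGraph V) (v : V)
    (D : Set V)
    (hD : ∀ n, H.Adj v n → ∃ d ∈ D, (H.deleteIncidenceSet v).Reachable n d) :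
    cyclomaticNumber (H.deleteIncidenceSet v) + (H.neighborSet v).ncard ≤
      cyclomaticNumber H + D.ncard := by
  have h1 := card_connectedComponent_deleteIncidenceSet_le H v D hD
  have h2 := edgeSet_ncard_deleteIncidenceSet H v
  unfold cyclomaticNumber
  omega

lemma cyclomaticNumber_deleteIncidenceSet_le_self [Finite V] (H : SimpleGraph V) (v : V) :
    cyclomaticNumber (H.deleteIncidenceSet v) ≤ cyclomaticNumber H := by
  have := cyclomaticNumber_deleteIncidenceSet_le H v (H.neighborSet v)
    fun n hn => ⟨n, hn, Reachable.refl _⟩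
  omega

lemma OnCycle.cyclomaticNumber_lt [Finite V] {H : SimpleGraph V} {v : V} (hv : OnCycle H v) :
    cyclomaticNumber (H.deleteIncidenceSet v) + 1 ≤ cyclomaticNumber H := by
  obtain ⟨a, b, hne, ha, hb, hr⟩ := hv
  have h1 := cyclomaticNumber_deleteIncidenceSet_le H v (H.neighborSet v \ {b}) (by
    intro n hn
    by_cases hnb : n = b
    · exact ⟨a, ⟨ha, hne⟩, hnb ▸ hr.symm⟩
    · exact ⟨n, ⟨hn, hnb⟩, Reachable.refl _⟩)
  have h2 := Set.ncard_sdiff_singleton_add_one (s := H.neighborSet v) (a := b) hb (Set.toFinite _)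
  omega

/-- If the neighbours of `v` meet two components of `H - v` at least twice each, then deleting `v`
destroys two independent cycles. -/
lemma cyclomaticNumber_add_two_le [Finite V] {H : SimpleGraph V} {v a b n n' : V}
    (hab : a ≠ b) (ha : H.Adj v a) (hb : H.Adj v b)
    (hr : (H.deleteIncidenceSet v).Reachable a b) (hnn : n ≠ n') (hn : H.Adj v n)
    (hn' : H.Adj v n') (hr' : (H.deleteIncidenceSet v).Reachable n n')
    (hsep : ¬ (H.deleteIncidenceSet v).Reachable n a) :
    cyclomaticNumber (H.deleteIncidenceSet v) + 2 ≤ cyclomaticNumber H := by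
  have hnb : n ≠ b := fun h => hsep (h ▸ hr.symm)
  have hn'b : n' ≠ b := fun h => hsep (hr'.trans (h ▸ hr.symm))
  have hn'a : n' ≠ a := fun h => hsep (h ▸ hr')
  have h1 := cyclomaticNumber_deleteIncidenceSet_le H v ((H.neighborSet v \ {b}) \ {n'}) (by
    intro m hm
    by_cases hmb : m = b
    · exact ⟨a, ⟨⟨ha, hab⟩, hn'a.symm⟩, hmb ▸ hr.symm⟩
    by_cases hmn : m = n'
    · exact ⟨n, ⟨⟨hn, hnb⟩, hnn⟩, hmn ▸ hr'.symm⟩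
    · exact ⟨m, ⟨⟨hm, hmb⟩, hmn⟩, Reachable.refl _⟩)
  have h2 := Set.ncard_sdiff_singleton_add_one (s := H.neighborSet v) (a := b) hb (Set.toFinite _)
  have h3 := Set.ncard_sdiff_singleton_add_one (s := H.neighborSet v \ {b}) (a := n')
    ⟨hn', hn'b⟩ (Set.toFinite _)
  omega

lemma cyclomaticNumber_of_no_edge [Finite V] {H : SimpleGraph V} (h : ∀ a b, ¬ H.Adj a b) :
    cyclomaticNumber H = 0 := by
  have hE : H.edgeSet = ∅ := by
    rw [edgeSet_eq_empty]
    ext a b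
    simp [h a b]
  have hC : Nat.card H.ConnectedComponent = Nat.card V := by
    refine (Nat.card_congr (Equiv.ofBijective H.connectedComponentMk ⟨fun a b hab => ?_, ?_⟩)).symm
    · exact (eq_of_reachable_of_isolated (h a) (ConnectedComponent.exact hab)).symm
    · exact fun C => C.exists_rep
  rw [cyclomaticNumber, hE, hC]
  simp

/-! ### Pendant vertices of acyclic graphs -/

/-- In an acyclic graph, the branch at `v` in the direction of a neighbour `a` has a pendant
vertex. -/
lemma exists_pendant_of_adj [Finite V] (H : SimpleGraph V) (hH : ∀ v, ¬ OnCycle H v) {v a : V}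
    (hva : H.Adj v a) :
    ∃ l u, IsPendant H u l ∧ l ≠ v ∧ (H.deleteIncidenceSet v).Reachable a l := by
  induction hm : H.edgeSet.ncard using Nat.strong_induction_on generalizing H v a with
  | _ m ih =>
  by_cases hb : ∃ b, (H.deleteIncidenceSet v).Adj a b
  · obtain ⟨b, hb⟩ := hb
    obtain ⟨l, u, hl, hla, hr⟩ := ih _ (hm ▸ edgeSet_ncard_deleteIncidenceSet_lt hva)
      (H.deleteIncidenceSet v) (fun x hx => hH x (hx.mono (H.deleteIncidenceSet_le v))) hb rfl
    have hal : (H.deleteIncidenceSet v).Reachable a l :=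
      hb.reachable.trans (hr.mono (deleteIncidenceSet_le _ a))
    have hul := deleteIncidenceSet_adj.1 hl.1
    refine ⟨l, u, ⟨hul.1, fun w hw => ?_⟩, hul.2.2, hal⟩
    by_cases hwv : w = v
    · subst hwv
      exact absurd ⟨a, l, hla.symm, hva, hw.symm, hal⟩ (hH w)
    · exact hl.2 w (deleteIncidenceSet_adj.2 ⟨hw, hul.2.2, hwv⟩)
  · refine ⟨a, v, ⟨hva, fun w hw => ?_⟩, hva.ne', Reachable.refl _⟩
    by_contra hwv
    exact hb ⟨w, deleteIncidenceSet_adj.2 ⟨hw, hva.ne', hwv⟩⟩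

/-- An acyclic graph with an edge has a vertex `v` adjacent to a pendant vertex `l` such that all
neighbours of `v` but at most one are pendant. -/
lemma exists_forall_adj_isPendant [Finite V] (H : SimpleGraph V) (hH : ∀ v, ¬ OnCycle H v)
    {a b : V} (hab : H.Adj a b) :
    ∃ v u l, H.Adj v u ∧ IsPendant H v l ∧ ∀ w, H.Adj v w → w ≠ u → IsPendant H v w := by
  -- The graph left after stripping off all pendant vertices at once.
  let K : SimpleGraph V :=
    { Adj := fun x y => H.Adj x y ∧ (¬ ∃ z, IsPendant H z x) ∧ ¬ ∃ z, IsPendant H z y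
      symm := ⟨fun x y h => ⟨h.1.symm, h.2.2, h.2.1⟩⟩
      loopless := ⟨fun x h => h.1.ne rfl⟩ }
  have hKH : K ≤ H := fun x y h => h.1
  have pend : ∀ {x y z : V}, IsPendant H z x → H.Adj y x → IsPendant H y x := by
    intro x y z hz hy
    rw [hz.2 y hy.symm]
    exact hz
  by_cases hK : ∃ x y, K.Adj x y
  · obtain ⟨x, y, hxy⟩ := hK
    obtain ⟨v, u, hv, -⟩ := exists_pendant_of_adj K (fun z hz => hH z (hz.mono hKH)) hxy
    have huv : K.Adj v u := hv.1.symm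
    have hrest : ∀ w, H.Adj v w → w ≠ u → IsPendant H v w := by
      intro w hw hwu
      by_contra hcon
      exact hwu (hv.2 w ⟨hw, huv.2.1, fun ⟨z, hz⟩ => hcon (pend hz hw)⟩)
    have hl : ∃ l, H.Adj v l ∧ l ≠ u := by
      by_contra! hcon
      exact huv.2.1 ⟨u, huv.1.symm, hcon⟩
    obtain ⟨l, hl, hlu⟩ := hl
    exact ⟨v, u, l, huv.1, hrest l hl hlu, hrest⟩
  · have main : ∀ {x y : V}, IsPendant H x y →
        ∃ v u l, H.Adj v u ∧ IsPendant H v l ∧ ∀ w, H.Adj v w → w ≠ u → IsPendant H v w := by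
      intro x y hxy
      refine ⟨x, y, y, hxy.1, hxy, fun w hw hwy => ?_⟩
      by_contra hcon
      refine hK ⟨x, w, hw, ?_, fun ⟨z, hz⟩ => hcon (pend hz hw)⟩
      rintro ⟨z, hz⟩
      exact hwy ((hz.2 w hw).trans (hz.2 y hxy.1).symm)
    by_cases ha : ∃ z, IsPendant H z a
    · exact main ha.choose_spec
    by_cases hb : ∃ z, IsPendant H z b
    · exact main hb.choose_spec
    · exact absurd ⟨a, b, hab, ha, hb⟩ hK

/-! ### The induced matching number -/

lemma ncard_le_inducedMatchingNumber [Finite V] {H : SimpleGraph V} (M : H.Subgraph)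
    (hM : IsInducedMatching M) : M.edgeSet.ncard ≤ inducedMatchingNumber H := by
  refine le_csSup ⟨H.edgeSet.ncard, ?_⟩ ⟨M, hM, rfl⟩
  rintro k ⟨M, -, rfl⟩
  exact Set.ncard_le_ncard M.edgeSet_subset (Set.toFinite _)

lemma exists_ncard_eq_inducedMatchingNumber [Finite V] (H : SimpleGraph V) :
    ∃ M : H.Subgraph, IsInducedMatching M ∧ M.edgeSet.ncard = inducedMatchingNumber H := by
  refine Nat.sSup_mem (s := {k : ℕ | ∃ M : H.Subgraph, IsInducedMatching M ∧
    M.edgeSet.ncard = k}) ⟨_, ⊥, ⟨?_, ?_⟩, rfl⟩ ⟨H.edgeSet.ncard, ?_⟩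
  · intro v hv
    simp at hv
  · intro v hv
    simp at hv
  · rintro k ⟨M, -, rfl⟩
    exact Set.ncard_le_ncard M.edgeSet_subset (Set.toFinite _)

lemma inducedMatchingNumber_deleteIncidenceSet_le [Finite V] (H : SimpleGraph V) (v : V) :
    inducedMatchingNumber (H.deleteIncidenceSet v) ≤ inducedMatchingNumber H := by
  obtain ⟨M, hM, hcard⟩ := exists_ncard_eq_inducedMatchingNumber (H.deleteIncidenceSet v)
  have hv : ∀ x ∈ M.verts, x ≠ v := fun x hx => by
    obtain ⟨y, hy, -⟩ := hM.1 hx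
    exact (deleteIncidenceSet_adj.1 hy.adj_sub).2.1
  let N : H.Subgraph :=
    { verts := M.verts
      Adj := M.Adj
      adj_sub := fun h => H.deleteIncidenceSet_le v h.adj_sub
      edge_vert := fun h => M.edge_vert h
      symm := M.symm }
  have hN : IsInducedMatching N := ⟨hM.1, fun x hx y hy hxy =>
    hM.2 hx hy (deleteIncidenceSet_adj.2 ⟨hxy, hv x hx, hv y hy⟩)⟩
  have hE : N.edgeSet = M.edgeSet := by
    ext e
    induction e using Sym2.ind
    rfl
  rw [← hcard, ← hE]
  exact ncard_le_inducedMatchingNumber N hN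

/-- An edge `ab` at distance at least two from every edge of an induced subgraph `K` can be added
to any induced matching of `K`. -/
lemma inducedMatchingNumber_add_one_le [Finite V] {K H : SimpleGraph V} (hKH : K ≤ H) {a b : V}
    (hab : H.Adj a b)
    (hind : ∀ x y x' y', K.Adj x x' → K.Adj y y' → H.Adj x y → K.Adj x y)
    (ha : ∀ x x', K.Adj x x' → x ≠ a ∧ ¬ H.Adj a x)
    (hb : ∀ x x', K.Adj x x' → x ≠ b ∧ ¬ H.Adj b x) :
    inducedMatchingNumber K + 1 ≤ inducedMatchingNumber H := by
  obtain ⟨M, hM, hcard⟩ := exists_ncard_eq_inducedMatchingNumber K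
  have hx : ∀ x ∈ M.verts, ∃ x', K.Adj x x' := fun x hx => by
    obtain ⟨y, hy, -⟩ := hM.1 hx
    exact ⟨y, hy.adj_sub⟩
  have haM : a ∉ M.verts := fun h => by
    obtain ⟨x', h'⟩ := hx a h
    exact (ha a x' h').1 rfl
  have hbM : b ∉ M.verts := fun h => by
    obtain ⟨x', h'⟩ := hx b h
    exact (hb b x' h').1 rfl
  let N : H.Subgraph :=
    { verts := M.verts ∪ {a, b}
      Adj := fun x y => M.Adj x y ∨ (x = a ∧ y = b) ∨ (x = b ∧ y = a)
      adj_sub := by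
        rintro x y (h | ⟨rfl, rfl⟩ | ⟨rfl, rfl⟩)
        · exact hKH h.adj_sub
        · exact hab
        · exact hab.symm
      edge_vert := by
        rintro x y (h | ⟨rfl, rfl⟩ | ⟨rfl, rfl⟩)
        · exact Or.inl (M.edge_vert h)
        · simp
        · simp
      symm := ⟨by
        rintro x y (h | h | h)
        · exact Or.inl h.symm
        · exact Or.inr (Or.inr h.symm)
        · exact Or.inr (Or.inl h.symm)⟩ }
  have hN : IsInducedMatching N := by
    constructor
    · rintro x (h | h | h)
      · obtain ⟨y, hy, huniq⟩ := hM.1 h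
        refine ⟨y, Or.inl hy, ?_⟩
        rintro z (hz | ⟨rfl, rfl⟩ | ⟨rfl, rfl⟩)
        · exact huniq z hz
        · exact absurd h haM
        · exact absurd h hbM
      · subst h
        refine ⟨b, Or.inr (Or.inl ⟨rfl, rfl⟩), ?_⟩
        rintro z (hz | ⟨-, rfl⟩ | ⟨h, -⟩)
        · exact absurd (M.edge_vert hz) haM
        · rfl
        · exact absurd h hab.ne
      · obtain rfl : x = b := h
        refine ⟨a, Or.inr (Or.inr ⟨rfl, rfl⟩), ?_⟩
        rintro z (hz | ⟨h, -⟩ | ⟨-, rfl⟩)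
        · exact absurd (M.edge_vert hz) hbM
        · exact absurd h hab.ne'
        · rfl
    · rintro x (h | rfl | h) y (h' | rfl | h') hxy
      · obtain ⟨x', hx'⟩ := hx x h
        obtain ⟨y', hy'⟩ := hx y h'
        exact Or.inl (hM.2 h h' (hind x y x' y' hx' hy' hxy))
      · obtain ⟨x', hx'⟩ := hx x h
        exact absurd hxy.symm (ha x x' hx').2
      · obtain rfl : y = b := h'
        obtain ⟨x', hx'⟩ := hx x h
        exact absurd hxy.symm (hb x x' hx').2
      · obtain ⟨y', hy'⟩ := hx y h'
        exact absurd hxy (ha y y' hy').2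
      · exact absurd hxy (H.loopless.irrefl _)
      · obtain rfl : y = b := h'
        exact Or.inr (Or.inl ⟨rfl, rfl⟩)
      · obtain rfl : x = b := h
        obtain ⟨y', hy'⟩ := hx y h'
        exact absurd hxy (hb y y' hy').2
      · obtain rfl : x = b := h
        exact Or.inr (Or.inr ⟨rfl, rfl⟩)
      · obtain rfl : x = b := h
        obtain rfl : y = x := h'
        exact absurd hxy (H.loopless.irrefl _)
  have hnot : s(a, b) ∉ M.edgeSet := fun h => haM (M.edge_vert h)
  have hsub : insert s(a, b) M.edgeSet ⊆ N.edgeSet := by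
    intro e he
    induction e using Sym2.ind with | _ x y
    rcases he with he | he
    · rw [he]
      exact Or.inr (Or.inl ⟨rfl, rfl⟩)
    · exact Or.inl he
  calc inducedMatchingNumber K + 1 = (insert s(a, b) M.edgeSet).ncard := by
        rw [Set.ncard_insert_of_notMem hnot (Set.toFinite _), hcard]
    _ ≤ N.edgeSet.ncard := Set.ncard_le_ncard hsub (Set.toFinite _)
    _ ≤ inducedMatchingNumber H := ncard_le_inducedMatchingNumber N hN

/-! ### Eigenspaces after deleting a vertex -/

/-- The `μ`-eigenspace of the adjacency matrix of `H`, without reference to a decision procedure for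
adjacency: the sum of `x` over the neighbours of `a` is `μ * x a`, for all `a`. -/
def eigSpace [Fintype V] (H : SimpleGraph V) (μ : ℝ) : Submodule ℝ (V → ℝ) where
  carrier := {x | ∀ a, ∑ b, (H.neighborSet a).indicator x b = μ * x a}
  zero_mem' := fun a => by simp
  add_mem' := fun {x y} hx hy a => by
    simp only [Set.indicator_add', Pi.add_apply, Finset.sum_add_distrib, hx a, hy a, mul_add]
  smul_mem' := fun c x hx a => by
    have : ∀ b, (H.neighborSet a).indicator (c • x) b = c * (H.neighborSet a).indicator x b :=
      fun b => by
        by_cases hb : b ∈ H.neighborSet a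
        · rw [Set.indicator_of_mem hb, Set.indicator_of_mem hb, Pi.smul_apply, smul_eq_mul]
        · rw [Set.indicator_of_notMem hb, Set.indicator_of_notMem hb, mul_zero]
    simp only [this, ← Finset.mul_sum, hx a, Pi.smul_apply, smul_eq_mul]
    ring

lemma mem_eigSpace [Fintype V] {H : SimpleGraph V} {μ : ℝ} {x : V → ℝ} :
    x ∈ eigSpace H μ ↔ ∀ a, ∑ b, (H.neighborSet a).indicator x b = μ * x a := Iff.rfl

lemma eigenMult_eq_finrank_eigSpace [Fintype V] [DecidableEq V] (H : SimpleGraph V)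
    [DecidableRel H.Adj] (μ : ℝ) : eigenMult H μ = Module.finrank ℝ (eigSpace H μ) := by
  have : Module.End.eigenspace (Matrix.toLin' (H.adjMatrix ℝ)) μ = eigSpace H μ := by
    ext x
    rw [Module.End.mem_eigenspace_iff, mem_eigSpace, funext_iff]
    refine forall_congr' fun a => ?_
    rw [Matrix.toLin'_apply, adjMatrix_mulVec_apply, Pi.smul_apply, smul_eq_mul]
    have : ∑ b, (H.neighborSet a).indicator x b = ∑ u ∈ H.neighborFinset a, x u := by
      rw [← Finset.sum_indicator_subset x (Finset.subset_univ (H.neighborFinset a)),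
        coe_neighborFinset]
    rw [this]
  rw [eigenMult, this]

lemma eq_zero_of_isolated [Fintype V] {H : SimpleGraph V} {μ : ℝ} (hμ : μ ≠ 0) {x : V → ℝ}
    (hx : x ∈ eigSpace H μ) {a : V} (ha : ∀ b, ¬ H.Adj a b) : x a = 0 := by
  have h := hx a
  rw [Finset.sum_eq_zero (fun b _ =>
    Set.indicator_of_notMem (show b ∉ H.neighborSet a from ha b) x)] at h
  exact (mul_eq_zero.1 h.symm).resolve_left hμ

lemma sum_eq_of_unique [Fintype V] {H : SimpleGraph V} {x : V → ℝ} {a n : V}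
    (hn : H.Adj a n) (h : ∀ b, H.Adj a b → b ≠ n → x b = 0) :
    ∑ b, (H.neighborSet a).indicator x b = x n := by
  rw [Finset.sum_eq_single n, Set.indicator_of_mem (show n ∈ H.neighborSet a from hn)]
  · intro b _ hb
    by_cases hab : H.Adj a b
    · rw [Set.indicator_of_mem (show b ∈ H.neighborSet a from hab), h b hab hb]
    · exact Set.indicator_of_notMem hab x
  · simp

lemma eq_zero_of_isPendant [Fintype V] {H : SimpleGraph V} {μ : ℝ} (hμ : μ ≠ 0) {x : V → ℝ}
    (hx : x ∈ eigSpace H μ) {v l : V} (hl : IsPendant H v l) (hv : x v = 0) : x l = 0 := by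
  have h := hx l
  rw [sum_eq_of_unique hl.1.symm (fun b hb hne => absurd (hl.2 b hb) hne), hv] at h
  exact (mul_eq_zero.1 h.symm).resolve_left hμ

lemma mem_eigSpace_deleteIncidenceSet [Fintype V] {H : SimpleGraph V} {μ : ℝ} {x : V → ℝ}
    {v : V} (hx : x ∈ eigSpace H μ) (hv : x v = 0) :
    x ∈ eigSpace (H.deleteIncidenceSet v) μ := by
  intro a
  by_cases ha : a = v
  · subst ha
    rw [hv, mul_zero]
    exact Finset.sum_eq_zero fun b _ =>
      Set.indicator_of_notMem (fun hb => (deleteIncidenceSet_adj.1 hb).2.1 rfl) x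
  · rw [← hx a]
    refine Finset.sum_congr rfl fun b _ => ?_
    by_cases hb : b = v
    · have h0 : ∀ s : Set V, s.indicator x b = 0 := fun s =>
        Set.indicator_apply_eq_zero.2 fun _ => hb ▸ hv
      rw [h0, h0]
    · have : b ∈ (H.deleteIncidenceSet v).neighborSet a ↔ b ∈ H.neighborSet a := by
        simp only [mem_neighborSet, deleteIncidenceSet_adj]
        tauto
      by_cases hab : b ∈ H.neighborSet a
      · rw [Set.indicator_of_mem hab, Set.indicator_of_mem (this.2 hab)]
      · rw [Set.indicator_of_notMem hab, Set.indicator_of_notMem (mt this.1 hab)]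

lemma mem_eigSpace_restrict_component [Fintype V] {K : SimpleGraph V} {μ : ℝ} {y : V → ℝ}
    (hy : y ∈ eigSpace K μ) (n : V) :
    Set.indicator {a | K.Reachable n a} y ∈ eigSpace K μ := by
  intro a
  by_cases ha : K.Reachable n a
  · rw [Set.indicator_of_mem (show a ∈ {a | K.Reachable n a} from ha), ← hy a]
    refine Finset.sum_congr rfl fun b _ => ?_
    by_cases hb : K.Adj a b
    · have : b ∈ {a | K.Reachable n a} := ha.trans hb.reachable
      simp [hb, this.out]
    · simp [hb]
  · rw [Set.indicator_of_notMem (show a ∉ {a | K.Reachable n a} from ha), mul_zero]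
    refine Finset.sum_eq_zero fun b _ => ?_
    by_cases hb : K.Adj a b
    · have : ¬ K.Reachable n b := fun h => ha (h.trans hb.symm.reachable)
      simp [this]
    · exact Set.indicator_of_notMem hb _

/-- Suppose every eigenvector of `K` is also one of `H`, and vanishes at `w`. If `n` is the only
`H`-neighbour of `w` in its `K`-component, then every eigenvector of `K` vanishes at `n`: restrict
it to that component and read the equation of `H` at `w`. -/
lemma eq_zero_of_eigSpace_le [Fintype V] {K H : SimpleGraph V} {μ : ℝ}
    (hle : eigSpace K μ ≤ eigSpace H μ) {w n : V} (hw : ∀ y ∈ eigSpace K μ, y w = 0)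
    (hn : H.Adj w n) (hsep : ∀ n', H.Adj w n' → n' ≠ n → ¬ K.Reachable n n')
    {y : V → ℝ} (hy : y ∈ eigSpace K μ) : y n = 0 := by
  have hz := mem_eigSpace_restrict_component hy n
  have h := hle hz w
  rw [hw _ hz, mul_zero, sum_eq_of_unique hn
    (fun b hb hbn => Set.indicator_of_notMem
      (show b ∉ {a | K.Reachable n a} from hsep b hb hbn) y)] at h
  rwa [Set.indicator_of_mem (show n ∈ {a | K.Reachable n a} from Reachable.refl _)] at h

/-- Fixing the value of a coordinate costs at most one dimension; if it costs exactly one, the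
bounding subspace `B` is cut out exactly. -/
lemma finrank_le_add_one_of_eval [Fintype V] {A B : Submodule ℝ (V → ℝ)} (v : V)
    (h : ∀ x ∈ A, x v = 0 → x ∈ B) :
    Module.finrank ℝ A ≤ Module.finrank ℝ B + 1 ∧
      (Module.finrank ℝ B + 1 ≤ Module.finrank ℝ A → B ≤ A) := by
  let φ : A →ₗ[ℝ] ℝ := (LinearMap.proj v).comp A.subtype
  have h1 := φ.finrank_range_add_finrank_ker
  have h2 : Module.finrank ℝ (LinearMap.range φ) ≤ 1 := by
    simpa using Submodule.finrank_le (LinearMap.range φ)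
  have h3 : Module.finrank ℝ ((LinearMap.ker φ).map A.subtype) =
      Module.finrank ℝ (LinearMap.ker φ) :=
    Submodule.finrank_map_subtype_eq _ _
  have h4 : (LinearMap.ker φ).map A.subtype ≤ B := by
    rintro _ ⟨x, hx, rfl⟩
    exact h x x.2 hx
  have h5 := Submodule.finrank_mono h4
  refine ⟨by omega, fun h6 => ?_⟩
  rw [← Submodule.eq_of_le_of_finrank_le h4 (by omega)]
  exact Submodule.map_subtype_le _ _

/-! ### The general bound -/

lemma multiplicity_le_delete [Fintype V] (H : SimpleGraph V) (μ : ℝ) (v : V) :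
    Module.finrank ℝ (eigSpace H μ) ≤
        Module.finrank ℝ (eigSpace (H.deleteIncidenceSet v) μ) + 1 ∧
      (Module.finrank ℝ (eigSpace (H.deleteIncidenceSet v) μ) + 1 ≤
          Module.finrank ℝ (eigSpace H μ) →
        eigSpace (H.deleteIncidenceSet v) μ ≤ eigSpace H μ) :=
  finrank_le_add_one_of_eval v fun _ hx hv => mem_eigSpace_deleteIncidenceSet hx hv

/-- If all neighbours of `v` except `u` are pendant, an eigenvector vanishing at `v` vanishes at
all its neighbours. So deleting both `u` and `v` lowers the multiplicity by at most one. -/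
lemma multiplicity_le_delete_two [Fintype V] {H : SimpleGraph V} {μ : ℝ} (hμ : μ ≠ 0) {v u : V}
    (hvu : H.Adj v u) (hp : ∀ w, H.Adj v w → w ≠ u → IsPendant H v w) :
    Module.finrank ℝ (eigSpace H μ) ≤
        Module.finrank ℝ (eigSpace ((H.deleteIncidenceSet v).deleteIncidenceSet u) μ) + 1 ∧
      (Module.finrank ℝ (eigSpace ((H.deleteIncidenceSet v).deleteIncidenceSet u) μ) + 1 ≤
          Module.finrank ℝ (eigSpace H μ) →
        eigSpace ((H.deleteIncidenceSet v).deleteIncidenceSet u) μ ≤ eigSpace H μ) := by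
  refine finrank_le_add_one_of_eval v fun x hx hv => ?_
  refine mem_eigSpace_deleteIncidenceSet (mem_eigSpace_deleteIncidenceSet hx hv) ?_
  have h := hx v
  rwa [hv, mul_zero, sum_eq_of_unique hvu
    (fun b hb hbu => eq_zero_of_isPendant hμ hx (hp b hb hbu) hv)] at h

lemma inducedMatchingNumber_delete_two [Finite V] {H : SimpleGraph V} {v u l : V}
    (hl : IsPendant H v l) (hp : ∀ w, H.Adj v w → w ≠ u → IsPendant H v w) :
    inducedMatchingNumber ((H.deleteIncidenceSet v).deleteIncidenceSet u) + 1 ≤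
      inducedMatchingNumber H := by
  refine inducedMatchingNumber_add_one_le
    ((deleteIncidenceSet_le _ u).trans (H.deleteIncidenceSet_le v)) hl.1 ?_ ?_ ?_
  · intro x y x' y' hx hy hxy
    simp only [deleteIncidenceSet_adj] at hx hy ⊢
    tauto
  · intro x x' hx
    simp only [deleteIncidenceSet_adj] at hx
    refine ⟨hx.1.2.1, fun hvx => hx.1.2.2 ((hp x hvx hx.2.1).2 x' hx.1.1)⟩
  · intro x x' hx
    simp only [deleteIncidenceSet_adj] at hx
    refine ⟨?_, fun hlx => hx.1.2.1 (hl.2 x hlx)⟩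
    rintro rfl
    exact hx.1.2.2 (hl.2 x' hx.1.1)

lemma cyclomaticNumber_delete_two_le [Finite V] (H : SimpleGraph V) (v u : V) :
    cyclomaticNumber ((H.deleteIncidenceSet v).deleteIncidenceSet u) ≤ cyclomaticNumber H :=
  (cyclomaticNumber_deleteIncidenceSet_le_self _ u).trans
    (cyclomaticNumber_deleteIncidenceSet_le_self H v)

lemma edgeSet_ncard_delete_two_lt [Finite V] {H : SimpleGraph V} {v w : V} (h : H.Adj v w)
    (u : V) :
    ((H.deleteIncidenceSet v).deleteIncidenceSet u).edgeSet.ncard < H.edgeSet.ncard :=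
  (edgeSet_ncard_mono (deleteIncidenceSet_le _ u)).trans_lt (edgeSet_ncard_deleteIncidenceSet_lt h)

/-- For `μ ≠ 0` the multiplicity is at most the induced matching number plus the cyclomatic
number. -/
theorem multiplicity_le [Fintype V] (H : SimpleGraph V) {μ : ℝ} (hμ : μ ≠ 0) :
    (Module.finrank ℝ (eigSpace H μ) : ℤ) ≤ inducedMatchingNumber H + cyclomaticNumber H := by
  induction hm : H.edgeSet.ncard using Nat.strong_induction_on generalizing H with
  | _ m ih =>
  by_cases hE : ∃ a b, H.Adj a b
  · by_cases hC : ∃ v, OnCycle H v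
    · obtain ⟨v, hv⟩ := hC
      have hlt : (H.deleteIncidenceSet v).edgeSet.ncard < m := by
        obtain ⟨a, -, -, ha, -⟩ := hv
        exact hm ▸ edgeSet_ncard_deleteIncidenceSet_lt ha
      have h1 := ih _ hlt _ rfl
      have h2 := (multiplicity_le_delete H μ v).1
      have h3 := inducedMatchingNumber_deleteIncidenceSet_le H v
      have h4 := hv.cyclomaticNumber_lt
      omega
    · obtain ⟨a, b, hab⟩ := hE
      obtain ⟨v, u, l, hvu, hl, hp⟩ :=
        exists_forall_adj_isPendant H (fun v hv => hC ⟨v, hv⟩) hab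
      have h1 := ih _ (hm ▸ edgeSet_ncard_delete_two_lt hvu u) _ rfl
      have h2 := (multiplicity_le_delete_two hμ hvu hp).1
      have h3 := inducedMatchingNumber_delete_two hl hp
      have h4 := cyclomaticNumber_delete_two_le H v u
      omega
  · have hE' : ∀ a b, ¬ H.Adj a b := fun a b h => hE ⟨a, b, h⟩
    have h1 : eigSpace H μ = ⊥ := by
      rw [Submodule.eq_bot_iff]
      intro x hx
      funext a
      exact eq_zero_of_isolated hμ hx (hE' a)
    rw [h1, cyclomaticNumber_of_no_edge hE', finrank_bot]
    omega

/-! ### Graphs attaining the bound -/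

/-- `H` attains the bound of `multiplicity_le`. -/
def IsTight [Fintype V] (H : SimpleGraph V) (μ : ℝ) : Prop :=
  (inducedMatchingNumber H : ℤ) + cyclomaticNumber H ≤ Module.finrank ℝ (eigSpace H μ)

/-- In a graph attaining the bound, every non-isolated vertex is in the support of some
eigenvector. -/
theorem IsTight.exists_ne_zero [Fintype V] {H : SimpleGraph V} {μ : ℝ} (hμ : μ ≠ 0)
    (hH : IsTight H μ) {w n : V} (hwn : H.Adj w n) : ∃ x ∈ eigSpace H μ, x w ≠ 0 := by
  induction hm : H.edgeSet.ncard using Nat.strong_induction_on generalizing H w n with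
  | _ m ih =>
  by_contra! hzero
  have hle : eigSpace H μ ≤ eigSpace (H.deleteIncidenceSet w) μ :=
    fun x hx => mem_eigSpace_deleteIncidenceSet hx (hzero x hx)
  have h1 := Submodule.finrank_mono hle
  have h2 := multiplicity_le (H.deleteIncidenceSet w) hμ
  have h3 := inducedMatchingNumber_deleteIncidenceSet_le H w
  have h4 := cyclomaticNumber_deleteIncidenceSet_le_self H w
  have hC : ¬ OnCycle H w := fun hw => by
    have := hw.cyclomaticNumber_lt
    unfold IsTight at hH
    omega
  have htight : IsTight (H.deleteIncidenceSet w) μ := by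
    unfold IsTight at hH ⊢
    omega
  have heq : eigSpace (H.deleteIncidenceSet w) μ ≤ eigSpace H μ :=
    (Submodule.eq_of_le_of_finrank_le hle (by unfold IsTight at hH; omega)).ge
  have hpend : ∀ k, H.Adj w k → IsPendant H w k := by
    intro k hk
    refine ⟨hk, fun z hz => ?_⟩
    by_contra hzw
    obtain ⟨y, hy, hyk⟩ := ih _ (hm ▸ edgeSet_ncard_deleteIncidenceSet_lt hwn) htight
      (w := k) (n := z) (deleteIncidenceSet_adj.2 ⟨hz, hk.ne', hzw⟩) rfl
    exact hyk (eq_zero_of_eigSpace_le heq (fun y hy => hzero y (heq hy)) hk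
      (fun k' hk' hne hr => hC ⟨k, k', hne.symm, hk, hk', hr⟩) hy)
  -- `w` is the centre of a star component, so deleting it costs an edge of the matching.
  have h5 := inducedMatchingNumber_delete_two (u := w) (hpend n hwn) (fun k hk _ => hpend k hk)
  have h6 : (H.deleteIncidenceSet w).deleteIncidenceSet w = H.deleteIncidenceSet w := by
    ext a b
    simp only [deleteIncidenceSet_adj]
    tauto
  rw [h6] at h5
  unfold IsTight at hH
  omega

/-- Deleting a cycle vertex `v` from a tight graph leaves a tight graph, and disconnects from each
other only pairs of vertices involving `v` or a vertex pendant at `v`. -/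
lemma IsTight.deleteIncidenceSet_of_onCycle [Fintype V] {H : SimpleGraph V} {μ : ℝ} (hμ : μ ≠ 0)
    (hH : IsTight H μ) {v : V} (hv : OnCycle H v) :
    IsTight (H.deleteIncidenceSet v) μ ∧
      ∀ p q, H.Reachable p q → (H.deleteIncidenceSet v).Reachable p q ∨
        (p = v ∨ IsPendant H v p) ∨ (q = v ∨ IsPendant H v q) := by
  set K := H.deleteIncidenceSet v with hK
  have h1 := (multiplicity_le_delete H μ v)
  have h2 := multiplicity_le K hμ
  have h3 := inducedMatchingNumber_deleteIncidenceSet_le H v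
  have h4 := hv.cyclomaticNumber_lt
  rw [← hK] at h1 h3 h4
  have htight : IsTight K μ := by
    unfold IsTight at hH ⊢
    omega
  have hle : eigSpace K μ ≤ eigSpace H μ := h1.2 (by unfold IsTight at hH; omega)
  have hv0 : ∀ y ∈ eigSpace K μ, y v = 0 := fun y hy =>
    eq_zero_of_isolated hμ hy fun b hb => (deleteIncidenceSet_adj.1 hb).2.1 rfl
  refine ⟨htight, fun p q hpq => ?_⟩
  obtain ⟨a, b, hab, ha, hb, hr⟩ := hv
  -- A component of `H - v` other than that of `a` contains only one neighbour of `v`.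
  have key : ∀ {x n : V}, H.Adj v n → K.Reachable x n → ¬ K.Reachable x a → IsPendant H v x := by
    intro x n hn hxn hxa
    have huniq : ∀ n', H.Adj v n' → n' ≠ n → ¬ K.Reachable n n' := by
      intro n' hn' hne hnn
      have := cyclomaticNumber_add_two_le hab ha hb hr hne.symm hn hn' hnn
        (fun h => hxa (hxn.trans h))
      rw [← hK] at this
      unfold IsTight at hH
      omega
    have hiso : ∀ z, ¬ K.Adj n z := fun z hz => by
      obtain ⟨y, hy, hyn⟩ := htight.exists_ne_zero hμ hz
      exact hyn (eq_zero_of_eigSpace_le hle hv0 hn huniq hy)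
    obtain rfl := eq_of_reachable_of_isolated hiso hxn.symm
    refine ⟨hn, fun z hz => ?_⟩
    by_contra hzv
    exact hiso z (deleteIncidenceSet_adj.2 ⟨hz, hn.ne', hzv⟩)
  by_cases hpa : K.Reachable p a
  · by_cases hqa : K.Reachable q a
    · exact Or.inl (hpa.trans hqa.symm)
    · rcases reachable_deleteIncidenceSet_or v hpq.symm with h | h | ⟨n, hn, h⟩
      · exact Or.inl h.symm
      · exact Or.inr (Or.inr (Or.inl h))
      · exact Or.inr (Or.inr (Or.inr (key hn h hqa)))
  · rcases reachable_deleteIncidenceSet_or v hpq with h | h | ⟨n, hn, h⟩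
    · exact Or.inl h
    · exact Or.inr (Or.inl (Or.inl h))
    · exact Or.inr (Or.inl (Or.inr (key hn h hpa)))

/-- A vertex determines the cycle vertex that it equals or is pendant at. -/
lemma cycle_vertex_unique {H : SimpleGraph V} {v v' p : V} (hv : OnCycle H v)
    (hv' : OnCycle H v') (h : p = v ∨ IsPendant H v p) (h' : p = v' ∨ IsPendant H v' p) :
    v = v' := by
  rcases h with rfl | h <;> rcases h' with rfl | h'
  · rfl
  · exact absurd hv h'.not_onCycle
  · exact absurd hv' h.not_onCycle
  · exact h'.2 v h.1.symm

/-- In an acyclic tight graph, let `v` be adjacent to a pendant vertex and let all neighbours of `v`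
other than `u` be pendant. Then deleting `u` and `v` leaves a tight graph, in which the neighbours
of `u` are isolated; so the component of `v` in `H` lies within distance one of `u` or `v`. -/
lemma IsTight.delete_two [Fintype V] {H : SimpleGraph V} {μ : ℝ} (hμ : μ ≠ 0)
    (hH : IsTight H μ) (hC : ∀ x, ¬ OnCycle H x) {v u l : V} (hvu : H.Adj v u)
    (hl : IsPendant H v l) (hp : ∀ w, H.Adj v w → w ≠ u → IsPendant H v w) :
    IsTight ((H.deleteIncidenceSet v).deleteIncidenceSet u) μ ∧
      ∀ p q, H.Reachable p q →
        ((H.deleteIncidenceSet v).deleteIncidenceSet u).Reachable p q ∨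
          p = v ∨ p = u ∨ H.Adj v p ∨ H.Adj u p := by
  set K := (H.deleteIncidenceSet v).deleteIncidenceSet u with hK
  have h1 := multiplicity_le_delete_two hμ hvu hp
  have h2 := multiplicity_le K hμ
  have h3 := inducedMatchingNumber_delete_two hl hp
  have h4 := cyclomaticNumber_delete_two_le H v u
  rw [← hK] at h1 h3 h4
  have htight : IsTight K μ := by
    unfold IsTight at hH ⊢
    omega
  have hle : eigSpace K μ ≤ eigSpace H μ := h1.2 (by unfold IsTight at hH; omega)
  have hu0 : ∀ y ∈ eigSpace K μ, y u = 0 := fun y hy =>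
    eq_zero_of_isolated hμ hy fun b hb => (deleteIncidenceSet_adj.1 hb).2.1 rfl
  have hKu : K ≤ H.deleteIncidenceSet u := deleteIncidenceSet_mono (H.deleteIncidenceSet_le v) u
  have hiso : ∀ n, H.Adj u n → ∀ z, ¬ K.Adj n z := fun n hn z hz => by
    obtain ⟨y, hy, hyn⟩ := htight.exists_ne_zero hμ hz
    exact hyn (eq_zero_of_eigSpace_le hle hu0 hn
      (fun n' hn' hne hr => hC u ⟨n, n', hne.symm, hn, hn', hr.mono hKu⟩) hy)
  refine ⟨htight, fun p q hpq => ?_⟩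
  have hvcase : ∀ n, H.Adj v n → (H.deleteIncidenceSet v).Reachable p n →
      p = v ∨ p = u ∨ H.Adj v p ∨ H.Adj u p := by
    intro n hn hr
    by_cases hnu : n = u
    · subst hnu
      rcases reachable_deleteIncidenceSet_or n hr with h | h | ⟨k, hk, h⟩
      · exact Or.inr (Or.inl (eq_of_reachable_deleteIncidenceSet h.symm))
      · exact Or.inr (Or.inl h)
      · have hk' := (deleteIncidenceSet_adj.1 hk).1
        rw [eq_of_reachable_of_isolated (hiso k hk') h.symm]
        exact Or.inr (Or.inr (Or.inr hk'))
    · have : p = n := eq_of_reachable_of_isolated (fun z hz => by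
        rw [deleteIncidenceSet_adj] at hz
        exact hz.2.2 ((hp n hn hnu).2 z hz.1)) hr.symm
      subst this
      exact Or.inr (Or.inr (Or.inl hn))
  rcases reachable_deleteIncidenceSet_or v hpq with h | h | ⟨n, hn, h⟩
  · rcases reachable_deleteIncidenceSet_or u h with h | h | ⟨k, hk, h⟩
    · exact Or.inl h
    · exact Or.inr (Or.inr (Or.inl h))
    · have hk' := (deleteIncidenceSet_adj.1 hk).1
      rw [eq_of_reachable_of_isolated (hiso k hk') h.symm]
      exact Or.inr (Or.inr (Or.inr (Or.inr hk')))
  · exact Or.inr (Or.inl h)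
  · exact Or.inr (hvcase n hn h)

/-- Two vertices within distance one of the ends of an edge are at distance at most three. -/
lemma exists_walk_length_le_three {H : SimpleGraph V} {v u p q : V} (hvu : H.Adj v u)
    (hp : p = v ∨ p = u ∨ H.Adj v p ∨ H.Adj u p) (hq : q = v ∨ q = u ∨ H.Adj v q ∨ H.Adj u q) :
    ∃ W : H.Walk p q, W.length ≤ 3 := by
  have key : ∀ {x : V}, (x = v ∨ x = u ∨ H.Adj v x ∨ H.Adj u x) →
      ∃ c, (c = v ∨ c = u) ∧ ∃ W : H.Walk c x, W.length ≤ 1 := by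
    rintro x (rfl | rfl | h | h)
    · exact ⟨x, Or.inl rfl, Walk.nil, by simp⟩
    · exact ⟨x, Or.inr rfl, Walk.nil, by simp⟩
    · exact ⟨v, Or.inl rfl, h.toWalk, by simp⟩
    · exact ⟨u, Or.inr rfl, h.toWalk, by simp⟩
  obtain ⟨c, hc, W, hW⟩ := key hp
  obtain ⟨d, hd, W', hW'⟩ := key hq
  have hcd : ∃ X : H.Walk c d, X.length ≤ 1 := by
    rcases hc with rfl | rfl <;> rcases hd with rfl | rfl
    · exact ⟨Walk.nil, by simp⟩
    · exact ⟨hvu.toWalk, by simp⟩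
    · exact ⟨hvu.symm.toWalk, by simp⟩
    · exact ⟨Walk.nil, by simp⟩
  obtain ⟨X, hX⟩ := hcd
  refine ⟨(W.reverse.append X).append W', ?_⟩
  simp only [Walk.length_append, Walk.length_reverse]
  omega

/-- The components of a graph attaining the bound have diameter at most three. -/
theorem IsTight.exists_walk_length_le_three [Fintype V] {H : SimpleGraph V} {μ : ℝ} (hμ : μ ≠ 0)
    (hH : IsTight H μ) {p q : V} (hpq : H.Reachable p q) :
    ∃ W : H.Walk p q, W.length ≤ 3 := by
  induction hm : H.edgeSet.ncard using Nat.strong_induction_on generalizing H with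
  | _ m ih =>
  have lift : ∀ K : SimpleGraph V, K ≤ H → K.edgeSet.ncard < m → IsTight K μ → K.Reachable p q →
      ∃ W : H.Walk p q, W.length ≤ 3 := by
    intro K hKH hlt hK hr
    obtain ⟨W, hW⟩ := ih _ hlt hK hr rfl
    exact ⟨W.mapLe hKH, by simpa using hW⟩
  by_cases hC : ∃ v, OnCycle H v
  · by_contra hcon
    have key : ∀ x, OnCycle H x → (p = x ∨ IsPendant H x p) ∨ (q = x ∨ IsPendant H x q) := by
      intro x hx
      obtain ⟨ht, hsep⟩ := hH.deleteIncidenceSet_of_onCycle hμ hx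
      refine (hsep p q hpq).resolve_left fun hr => hcon (lift _ (H.deleteIncidenceSet_le x) ?_ ht hr)
      obtain ⟨a, -, -, ha, -⟩ := hx
      exact hm ▸ edgeSet_ncard_deleteIncidenceSet_lt ha
    -- There are at least three cycle vertices, but `p` and `q` account for at most one each.
    obtain ⟨v, hv⟩ := hC
    obtain ⟨a, b, hab, ha, hb, hr⟩ := id hv
    have hva := onCycle_of_adj hab ha hb hr
    have hvb := onCycle_of_adj hab.symm hb ha hr.symm
    rcases key v hv with h1 | h1 <;> rcases key a hva with h2 | h2 <;>
      rcases key b hvb with h3 | h3 <;>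
      first
      | exact ha.ne (cycle_vertex_unique hv hva h1 h2)
      | exact hb.ne (cycle_vertex_unique hv hvb h1 h3)
      | exact hab (cycle_vertex_unique hva hvb h2 h3)
  · obtain ⟨P⟩ := id hpq
    cases P with
    | nil => exact ⟨Walk.nil, by simp⟩
    | cons hadj _ =>
      have hC' : ∀ x, ¬ OnCycle H x := fun x hx => hC ⟨x, hx⟩
      obtain ⟨v, u, l, hvu, hl, hp⟩ := exists_forall_adj_isPendant H hC' hadj
      obtain ⟨ht, hsep⟩ := hH.delete_two hμ hC' hvu hl hp
      have hK := lift _ ((deleteIncidenceSet_le _ u).trans (H.deleteIncidenceSet_le v))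
        (hm ▸ edgeSet_ncard_delete_two_lt hvu u) ht
      rcases hsep p q hpq with h | h
      · exact hK h
      rcases hsep q p hpq.symm with h' | h'
      · exact hK h'.symm
      · exact GraphMultiplicity.exists_walk_length_le_three hvu h h'

end GraphMultiplicity

theorem corollary3p2 {V : Type*} [Fintype V] [DecidableEq V] (G : SimpleGraph V)
    [DecidableRel G.Adj] (hG : G.Connected) (hdiam : 4 ≤ G.diam) (μ : ℝ) (hμ0 : μ ≠ 0)
    (hμ : Module.End.HasEigenvalue (Matrix.toLin' (G.adjMatrix ℝ)) μ) :
    (GraphMultiplicity.eigenMult G μ : ℤ) ≤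
      (GraphMultiplicity.inducedMatchingNumber G : ℤ) +
        GraphMultiplicity.cyclomaticNumber G - 1 := by
  by_contra hcon
  have htight : GraphMultiplicity.IsTight G μ := by
    rw [GraphMultiplicity.eigenMult_eq_finrank_eigSpace] at hcon
    unfold GraphMultiplicity.IsTight
    omega
  have := hG.nonempty
  obtain ⟨p, q, hpq⟩ := G.exists_dist_eq_diam
  obtain ⟨W, hW⟩ := htight.exists_walk_length_le_three hμ0 (hG p q)
  have := dist_le W
  omega
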